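/- Let $n\ge 1$ and let $(M,g)$ be a spacetime of dimension $n+1$, i.e. a smooth manifold with a smooth Lorentzian metric of signature $(-,+,\dots,+)$, with Levi-Civita connection $\nabla$. Suppose that $M$ admits a spacetime convex function, i.e. a smooth function $f:M\to\mathbb{R}$ whose Hessian $\nabla_\mu\nabla_\nu f$ has Lorentzian signature $(-,+,\dots,+)$ at every point and for which there is a constant $c>0$ such that $$V^\mu V^\nu\nabla_\mu\nabla_\nu f\;\ge\; c\,g_{\mu\nu}V^\mu V^\nu\qquad\text{for all tangent vectors } V\in TM .$$ Let $\Sigma$ be a nonempty smooth spacelike hypersurface (immersed $n$-manifold without boundary) in $M$, with induced Riemannian metric $h_{ij}$ and second fundamental form $K_{ij}$ with respect to a timelike unit normal. If $\Sigma$ is maximal, i.e. $h^{ij}K_{ij}=0$ on $\Sigma$ (in particular, if $\Sigma$ is totally geodesic, $K_{ij}=0$), then $(\Sigma,h)$ cannot be closed, i.e. $\Sigma$ is not compact. -/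

import Mathlib

open scoped Manifold ContDiff

noncomputable section

namespace SpacetimeConvex

/-- The model space `ℝᵐ`. -/
abbrev Model (m : ℕ) : Type := EuclideanSpace ℝ (Fin m)

/-- The standard basis `e₀, …, e_{m-1}` of `ℝᵐ`. -/
def e {m : ℕ} (i : Fin m) : Model m := EuclideanSpace.single i 1

/-- A bilinear form on an `(n+1)`-dimensional space has Lorentzian signature `(-, +, …, +)`. -/
def IsLorentzian (n : ℕ) (B : LinearMap.BilinForm ℝ (Model (n + 1))) : Prop :=
  sigNeg B.toQuadraticMap = 1 ∧ sigPos B.toQuadraticMap = n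

/-- A continuous bilinear form, as a plain bilinear form. -/
def asBilin {m : ℕ} (B : Model m →L[ℝ] Model m →L[ℝ] ℝ) : LinearMap.BilinForm ℝ (Model m) :=
  LinearMap.mk₂ ℝ (fun v w => B v w) (by simp) (by simp) (by simp) (by simp)

/-- A smooth Lorentzian metric of signature `(-, +, …, +)` on an `(n+1)`-manifold `M`. -/
structure LorentzianMetric (n : ℕ) (M : Type*) [TopologicalSpace M]
    [ChartedSpace (Model (n + 1)) M] [IsManifold (𝓡 (n + 1)) ∞ M] where
  /-- The bilinear form `g_x` on `T_x M`. -/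
  inner (x : M) : TangentSpace (𝓡 (n + 1)) x →L[ℝ] TangentSpace (𝓡 (n + 1)) x →L[ℝ] ℝ
  symm (x : M) (v w : TangentSpace (𝓡 (n + 1)) x) : inner x v w = inner x w v
  lorentzian (x : M) : IsLorentzian n (asBilin (inner x))
  contMDiff : ContMDiff (𝓡 (n + 1))
    ((𝓡 (n + 1)).prod 𝓘(ℝ, Model (n + 1) →L[ℝ] Model (n + 1) →L[ℝ] ℝ)) ∞
    (fun x => Bundle.TotalSpace.mk' (Model (n + 1) →L[ℝ] Model (n + 1) →L[ℝ] ℝ) x (inner x))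

section Spacetime

variable {n : ℕ} {M : Type*} [TopologicalSpace M] [ChartedSpace (Model (n + 1)) M]
  [IsManifold (𝓡 (n + 1)) ∞ M]

/-- The components `g_{ab}` of the metric in the preferred chart at `x`, as functions of the
coordinates `y`: `g_{ab}(y) = g(∂_a, ∂_b)` at the point with coordinates `y`. -/
def LorentzianMetric.coord (g : LorentzianMetric n M) (x : M) (y : Model (n + 1)) :
    Matrix (Fin (n + 1)) (Fin (n + 1)) ℝ :=
  Matrix.of fun a b =>
    g.inner ((extChartAt (𝓡 (n + 1)) x).symm y)
      (mfderiv 𝓘(ℝ, Model (n + 1)) (𝓡 (n + 1)) (extChartAt (𝓡 (n + 1)) x).symm y (e a))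
      (mfderiv 𝓘(ℝ, Model (n + 1)) (𝓡 (n + 1)) (extChartAt (𝓡 (n + 1)) x).symm y (e b))

/-- The partial derivative `∂_c g_{ab}` at `x`, in the preferred chart at `x`. -/
def LorentzianMetric.dCoord (g : LorentzianMetric n M) (x : M) (c a b : Fin (n + 1)) : ℝ :=
  fderiv ℝ (fun y => g.coord x y a b) (extChartAt (𝓡 (n + 1)) x x) (e c)

/-- The Christoffel symbol `Γ^c_{ab}` of the Levi-Civita connection at `x`, in the preferred chart
at `x`: `Γ^c_{ab} = ½ g^{cd} (∂_a g_{db} + ∂_b g_{da} - ∂_d g_{ab})`. -/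
def LorentzianMetric.christoffel (g : LorentzianMetric n M) (x : M) (c a b : Fin (n + 1)) : ℝ :=
  (1 / 2) * ∑ d, (g.coord x (extChartAt (𝓡 (n + 1)) x x))⁻¹ c d *
    (g.dCoord x a d b + g.dCoord x b d a - g.dCoord x d a b)

/-- The coordinate expression of `f : M → ℝ` in the preferred chart at `x`. -/
def coordFun (f : M → ℝ) (x : M) (y : Model (n + 1)) : ℝ :=
  f ((extChartAt (𝓡 (n + 1)) x).symm y)

/-- The components `∇_a ∇_b f = ∂_a ∂_b f - Γ^c_{ab} ∂_c f` of the Hessian of `f` at `x`. -/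
def LorentzianMetric.hessianCoord (g : LorentzianMetric n M) (f : M → ℝ) (x : M) :
    Matrix (Fin (n + 1)) (Fin (n + 1)) ℝ :=
  Matrix.of fun a b =>
    fderiv ℝ (fderiv ℝ (coordFun f x)) (extChartAt (𝓡 (n + 1)) x x) (e a) (e b) -
      ∑ c, g.christoffel x c a b * fderiv ℝ (coordFun f x) (extChartAt (𝓡 (n + 1)) x x) (e c)

/-- The Hessian `∇∇f` at `x`, as a bilinear form on `T_x M` (which Mathlib identifies with the
model space through the preferred chart at `x`). -/
def LorentzianMetric.hessian (g : LorentzianMetric n M) (f : M → ℝ) (x : M) :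
    LinearMap.BilinForm ℝ (Model (n + 1)) :=
  Matrix.toBilin (EuclideanSpace.basisFun (Fin (n + 1)) ℝ).toBasis (g.hessianCoord f x)

/-- Spacetime convex functions: smooth functions whose Hessian has Lorentzian signature everywhere
and satisfies `V^a V^b ∇_a ∇_b f ≥ c g_{ab} V^a V^b` on all tangent vectors, for a constant
`c > 0`. -/
structure IsSpacetimeConvex (g : LorentzianMetric n M) (f : M → ℝ) : Prop where
  smooth : ContMDiff (𝓡 (n + 1)) 𝓘(ℝ, ℝ) ∞ f
  lorentzian : ∀ x, IsLorentzian n (g.hessian f x)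
  convex : ∃ c : ℝ, 0 < c ∧ ∀ (x : M) (V : TangentSpace (𝓡 (n + 1)) x),
    c * g.inner x V V ≤ g.hessian f x V V

end Spacetime

section Hypersurface

variable {n : ℕ} {M : Type*} [TopologicalSpace M] [ChartedSpace (Model (n + 1)) M]
  [IsManifold (𝓡 (n + 1)) ∞ M] {S : Type*} [TopologicalSpace S] [ChartedSpace (Model n) S]

/-- `ι : S → M` is a smooth spacelike (immersed) hypersurface: the induced form `h = ι^* g` is
positive definite, i.e. a Riemannian metric. In particular every `dι_p` is injective. -/
structure IsSpacelikeHypersurface (g : LorentzianMetric n M) (ι : S → M) : Prop where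
  smooth : ContMDiff (𝓡 n) (𝓡 (n + 1)) ∞ ι
  spacelike : ∀ (p : S) (v : TangentSpace (𝓡 n) p), v ≠ 0 →
    0 < g.inner (ι p) (mfderiv (𝓡 n) (𝓡 (n + 1)) ι p v) (mfderiv (𝓡 n) (𝓡 (n + 1)) ι p v)

/-- The components `h_{ij}` of the induced metric `h = ι^* g` at `p`. -/
def inducedMetric (g : LorentzianMetric n M) (ι : S → M) (p : S) : Matrix (Fin n) (Fin n) ℝ :=
  Matrix.of fun i j =>
    g.inner (ι p) (mfderiv (𝓡 n) (𝓡 (n + 1)) ι p (e i)) (mfderiv (𝓡 n) (𝓡 (n + 1)) ι p (e j))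

/-- `ν ∈ T_{ι p} M` is a (timelike) unit normal of the hypersurface at `p`. -/
def IsUnitNormal (g : LorentzianMetric n M) (ι : S → M) (p : S)
    (ν : TangentSpace (𝓡 (n + 1)) (ι p)) : Prop :=
  g.inner (ι p) ν ν = -1 ∧
    ∀ v : TangentSpace (𝓡 n) p, g.inner (ι p) ν (mfderiv (𝓡 n) (𝓡 (n + 1)) ι p v) = 0

/-- The coordinate expression of `ι` in the preferred charts at `p` and `ι p`. -/
def coordMap (ι : S → M) (p : S) : Model n → Model (n + 1) :=
  writtenInExtChartAt (𝓡 n) (𝓡 (n + 1)) p ι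

/-- The covariant derivative `∇_i ∂_j ι` at `p`, along the hypersurface and with respect to the
Levi-Civita connection of `g`, of the coordinate vector field `∂_j ι`; its components are
`∂_i ∂_j ι^c + Γ^c_{ab} ∂_i ι^a ∂_j ι^b`. -/
def covDeriv (g : LorentzianMetric n M) (ι : S → M) (p : S) (i j : Fin n) :
    TangentSpace (𝓡 (n + 1)) (ι p) :=
  let φ : Model n → Model (n + 1) := coordMap ι p
  let y : Model n := extChartAt (𝓡 n) p p
  fderiv ℝ (fderiv ℝ φ) y (e i) (e j) +
    ∑ c, (∑ a, ∑ b, g.christoffel (ι p) c a b * (fderiv ℝ φ y (e i)) a * (fderiv ℝ φ y (e j)) b) •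
      e c

/-- The components of the second fundamental form with respect to the unit normal `ν` at `p`:
`K_{ij} = g(∇_i ν, ∂_j ι) = - g(ν, ∇_i ∂_j ι)`. -/
def secondFundamentalForm (g : LorentzianMetric n M) (ι : S → M) (p : S)
    (ν : TangentSpace (𝓡 (n + 1)) (ι p)) : Matrix (Fin n) (Fin n) ℝ :=
  Matrix.of fun i j => -g.inner (ι p) ν (covDeriv g ι p i j)

/-- The mean curvature `h^{ij} K_{ij}` at `p` with respect to the unit normal `ν`. -/
def meanCurvature (g : LorentzianMetric n M) (ι : S → M) (p : S)
    (ν : TangentSpace (𝓡 (n + 1)) (ι p)) : ℝ :=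
  ∑ i, ∑ j, (inducedMetric g ι p)⁻¹ i j * secondFundamentalForm g ι p ν i j

/-- The hypersurface is maximal: `h^{ij} K_{ij} = 0` at every point. This does not depend on the
choice between the two unit normals `ν` and `-ν` of a spacelike hypersurface at a point. -/
def IsMaximal (g : LorentzianMetric n M) (ι : S → M) : Prop :=
  ∀ (p : S) (ν : TangentSpace (𝓡 (n + 1)) (ι p)), IsUnitNormal g ι p ν →
    meanCurvature g ι p ν = 0

end Hypersurface

end SpacetimeConvex

end

/-! If the hypersurface were compact, `f ∘ ι` would have a maximum at some `p`. There `df` kills the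
tangent space of the hypersurface, so `df = -df(ν) g(ν, ·)`, and the second order condition reads
`∇∇f(v, v) + df(ν) K(v, v) ≤ 0` for tangent `v`. Convexity bounds the Hessian below by `c h(v, v)`,
hence `-df(ν) K - c h` is positive semidefinite. Its trace with respect to `h` is `-c n`, as `K` is
traceless, and this is negative: a contradiction. The normal comes from
`exists_timelike_unit_normal`, the conditions at `p` from `maximum_point_conditions`, and the sign
of the trace from `sum_inv_mul_nonneg`. -/

namespace SpacetimeConvex

/-! ### Linear algebra: unit normals and traces -/

/-- A form with a negative direction that is positive definite on the range of `L`, of codimension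
one, has a unit timelike vector orthogonal to this range, and the two span the whole space. -/
theorem exists_timelike_unit_normal {E F : Type*} [AddCommGroup E] [Module ℝ E]
    [FiniteDimensional ℝ E] [AddCommGroup F] [Module ℝ F] [FiniteDimensional ℝ F]
    (B : LinearMap.BilinForm ℝ E) (hB : ∀ x y, B x y = B y x) (L : F →ₗ[ℝ] E)
    (hL : ∀ v, v ≠ 0 → 0 < B (L v) (L v))
    (hdim : Module.finrank ℝ E = Module.finrank ℝ F + 1) {t : E} (ht : B t t < 0) :
    ∃ ν, B ν ν = -1 ∧ (∀ v, B ν (L v) = 0) ∧ ∀ x, ∃ v, x = L v - B ν x • ν := by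
  have hinj : Function.Injective L := by
    rw [injective_iff_map_eq_zero]
    intro v hv
    by_contra h
    simpa [hv] using hL v h
  have hrefl : B.IsRefl := fun x y h => by rw [hB, h]
  -- Positive definiteness on the range makes the restriction nondegenerate, so the space splits as
  -- the range plus its orthogonal complement.
  have hnd : (B.restrict (LinearMap.range L)).Nondegenerate := by
    refine (LinearMap.IsRefl.nondegenerate_iff_separatingLeft
      (B := B.restrict (LinearMap.range L)) fun x y h => hrefl _ _ h).2 ?_
    rintro ⟨x, v, rfl⟩ h
    by_contra hx
    have hv : v ≠ 0 := fun h0 => hx (by ext; simp [h0])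
    exact (hL v hv).ne' (h ⟨L v, v, rfl⟩)
  have hc := LinearMap.BilinForm.isCompl_orthogonal_of_restrict_nondegenerate hrefl hnd
  have hort : ∀ u ∈ B.orthogonal (LinearMap.range L), ∀ v, B u (L v) = 0 := fun u hu v => by
    rw [hB]; exact hu _ ⟨v, rfl⟩
  have hdec : ∀ x, ∃ v, ∃ u ∈ B.orthogonal (LinearMap.range L), x = L v + u := fun x => by
    have hx : x ∈ LinearMap.range L ⊔ B.orthogonal (LinearMap.range L) := by
      rw [hc.sup_eq_top]; trivial
    obtain ⟨_, ⟨v, rfl⟩, u, hu, rfl⟩ := Submodule.mem_sup.1 hx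
    exact ⟨v, u, hu, rfl⟩
  obtain ⟨v₀, u, hu, rfl⟩ := hdec t
  have hneg : B u u < 0 := by
    have h1 : 0 ≤ B (L v₀) (L v₀) := by
      by_cases h : v₀ = 0
      · simp [h]
      · exact (hL _ h).le
    have h2 := hort u hu v₀
    have h3 : B (L v₀) u = 0 := by rw [hB, h2]
    simp only [map_add, LinearMap.add_apply, h2, h3] at ht
    linarith
  have hu0 : u ≠ 0 := by rintro rfl; simp at hneg
  have hfin : Module.finrank ℝ (B.orthogonal (LinearMap.range L)) = 1 := by
    have h1 := Submodule.finrank_add_eq_of_isCompl hc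
    rw [LinearMap.finrank_range_of_inj hinj] at h1
    omega
  have hs : 0 < √(-B u u) := Real.sqrt_pos.2 (by linarith)
  have hss : √(-B u u) * √(-B u u) = -B u u := Real.mul_self_sqrt (by linarith)
  have hνν : B ((√(-B u u))⁻¹ • u) ((√(-B u u))⁻¹ • u) = -1 := by
    simp only [map_smul, LinearMap.smul_apply, smul_eq_mul]
    field_simp
    rw [sq]
    linarith
  refine ⟨(√(-B u u))⁻¹ • u, hνν, fun v => by simp [hort u hu v], fun x => ?_⟩
  obtain ⟨v, w, hw, rfl⟩ := hdec x
  -- The complement is a line, so `w` is a multiple of `u`. The coefficient along `ν` is `-B ν x`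
  -- because `B ν ν = -1`.
  obtain ⟨a, ha⟩ := (finrank_eq_one_iff_of_nonzero' (⟨u, hu⟩ : B.orthogonal (LinearMap.range L))
    (fun h => hu0 (congrArg Subtype.val h))).1 hfin ⟨w, hw⟩
  have ha' : w = (a * √(-B u u)) • ((√(-B u u))⁻¹ • u) := by
    rw [smul_smul, mul_assoc, mul_inv_cancel₀ hs.ne', mul_one]
    exact (congrArg Subtype.val ha).symm
  refine ⟨v, ?_⟩
  have h4 : B ((√(-B u u))⁻¹ • u) (L v) = 0 := by simp [hort u hu v]
  rw [map_add, h4, ha', map_smul, hνν]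
  simp

theorem IsLorentzian.exists_neg {n : ℕ} {B : LinearMap.BilinForm ℝ (Model (n + 1))}
    (hB : IsLorentzian n B) : ∃ t, B t t < 0 := by
  obtain ⟨V, hV, hdef⟩ := exists_finrank_eq_sigNeg_and_negDef B.toQuadraticMap
  rw [hB.1] at hV
  have : Nontrivial V := Module.nontrivial_of_finrank_pos (R := ℝ) (by omega)
  obtain ⟨t, ht⟩ := exists_ne (0 : V)
  exact ⟨t, by simpa using hdef t ht⟩

open scoped MatrixOrder Matrix.Norms.L2Operator in
/-- The trace of a matrix with nonnegative quadratic form, with respect to a positive definite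
metric, is nonnegative. -/
theorem sum_inv_mul_nonneg {ι : Type*} [Fintype ι] [DecidableEq ι] {h A : Matrix ι ι ℝ}
    (hh : h.PosDef) (hA : ∀ v : ι → ℝ, 0 ≤ ∑ i, ∑ j, v i * v j * A i j) :
    0 ≤ ∑ i, ∑ j, h⁻¹ i j * A i j := by
  -- With `h⁻¹ = Cᵀ C`, the trace is the sum of the values of the quadratic form of `A` on the rows
  -- of `C`.
  obtain ⟨C, hC⟩ := CStarAlgebra.nonneg_iff_eq_star_mul_self.1 hh.inv.posSemidef.nonneg
  have : ∑ i, ∑ j, h⁻¹ i j * A i j = ∑ k, ∑ i, ∑ j, C k i * C k j * A i j := by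
    simp_rw [hC, Matrix.mul_apply, Matrix.star_apply, star_trivial, Finset.sum_mul]
    rw [Finset.sum_comm]
    refine (Finset.sum_congr rfl fun j _ => Finset.sum_comm).trans ?_
    rw [Finset.sum_comm]
    exact Finset.sum_congr rfl fun k _ => Finset.sum_comm
  rw [this]
  exact Finset.sum_nonneg fun k _ => hA (C k)

/-! ### Second order calculus -/

/-- The necessary second order condition at a local maximum. -/
theorem _root_.IsLocalMax.fderiv_fderiv_nonpos {E : Type*} [NormedAddCommGroup E] [NormedSpace ℝ E]
    {u : E → ℝ} {y : E} (hmax : IsLocalMax u y) (hu : ContDiffAt ℝ 2 u y) (v : E) :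
    fderiv ℝ (fderiv ℝ u) y v v ≤ 0 := by
  set l : ℝ → E := fun t => y + t • v
  have hl : ∀ t, HasDerivAt l v t := fun t => by
    simpa [l] using ((hasDerivAt_id t).smul_const v).const_add y
  have hl0 : l 0 = y := by simp [l]
  have hlim : Filter.Tendsto l (nhds 0) (nhds y) := by
    simpa [hl0] using (hl 0).continuousAt.tendsto
  have hd1 : deriv (u ∘ l) =ᶠ[nhds 0] fun t => fderiv ℝ u (l t) v := by
    have : ∀ᶠ z in nhds y, ContDiffAt ℝ 2 u z := hu.eventually (by simp)
    filter_upwards [hlim.eventually this] with t ht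
    exact ((ht.differentiableAt (by simp)).hasFDerivAt.comp_hasDerivAt t (hl t)).deriv
  have hd2 : deriv (deriv (u ∘ l)) 0 = fderiv ℝ (fderiv ℝ u) y v v := by
    rw [hd1.deriv_eq]
    have h1 : DifferentiableAt ℝ (fderiv ℝ u) (l 0) := by
      rw [hl0]
      exact (hu.fderiv_right (m := 1) (by norm_num)).differentiableAt (by simp)
    have h2 := (h1.hasFDerivAt.comp_hasDerivAt 0 (hl 0)).clm_apply (hasDerivAt_const 0 v)
    rw [hl0] at h2
    simpa using h2.deriv
  have hmax' : IsLocalMax (u ∘ l) 0 := by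
    have : ∀ᶠ t in nhds 0, u (l t) ≤ u y := hlim.eventually hmax
    simpa [IsLocalMax, IsMaxFilter, hl0] using this
  have hcont : ContinuousAt (u ∘ l) 0 :=
    ContinuousAt.comp (by rw [hl0]; exact hu.continuousAt) (hl 0).continuousAt
  -- A positive second derivative would make the maximum also a local minimum, so the function would
  -- be constant along the line near `0`, with second derivative zero.
  by_contra! hpos
  have hmin := isLocalMin_of_deriv_deriv_pos (by rw [hd2]; exact hpos) hmax'.deriv_eq_zero hcont
  have hconst : u ∘ l =ᶠ[nhds 0] fun _ => (u ∘ l) 0 := by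
    filter_upwards [hmin, hmax'] with t h1 h2 using le_antisymm h2 h1
  have := hconst.deriv.deriv_eq
  rw [hd2] at this
  simp at this
  linarith

/-- The second term, from the curvature of `φ`, is what later supplies the second fundamental form.
-/
theorem fderiv_fderiv_comp_apply {E F : Type*} [NormedAddCommGroup E] [NormedSpace ℝ E]
    [NormedAddCommGroup F] [NormedSpace ℝ F] {u : F → ℝ} {φ : E → F} {y : E}
    (hu : ContDiffAt ℝ 2 u (φ y)) (hφ : ContDiffAt ℝ 2 φ y) (v w : E) :
    fderiv ℝ (fderiv ℝ (u ∘ φ)) y v w =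
      fderiv ℝ (fderiv ℝ u) (φ y) (fderiv ℝ φ y v) (fderiv ℝ φ y w) +
        fderiv ℝ u (φ y) (fderiv ℝ (fderiv ℝ φ) y v w) := by
  have h1 : fderiv ℝ (u ∘ φ) =ᶠ[nhds y] fun z => (fderiv ℝ u (φ z)).comp (fderiv ℝ φ z) := by
    have a : ∀ᶠ z in nhds (φ y), ContDiffAt ℝ 2 u z := hu.eventually (by simp)
    filter_upwards [hφ.continuousAt.eventually a, hφ.eventually (by simp)] with z hz hz'
    exact fderiv_comp z (hz.differentiableAt (by simp)) (hz'.differentiableAt (by simp))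
  have hu1 : DifferentiableAt ℝ (fderiv ℝ u) (φ y) :=
    (hu.fderiv_right (m := 1) (by norm_num)).differentiableAt (by simp)
  have hφ1 : DifferentiableAt ℝ (fderiv ℝ φ) y :=
    (hφ.fderiv_right (m := 1) (by norm_num)).differentiableAt (by simp)
  have hφ0 := (hφ.differentiableAt (by simp)).hasFDerivAt
  have h2 := (hu1.hasFDerivAt.comp y hφ0).clm_comp hφ1.hasFDerivAt
  rw [h1.fderiv_eq]
  erw [h2.fderiv]
  simp [add_comm]

/-! ### Coordinate expressions of `f` and `ι` -/

section

variable {n : ℕ} {M : Type*} [TopologicalSpace M] [ChartedSpace (Model (n + 1)) M]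
  {S : Type*} [TopologicalSpace S] [ChartedSpace (Model n) S] {ι : S → M}

theorem contDiffAt_coordFun {f : M → ℝ} (hf : ContMDiff (𝓡 (n + 1)) 𝓘(ℝ, ℝ) ∞ f) (x : M) :
    ContDiffAt ℝ ∞ (coordFun f x) (extChartAt (𝓡 (n + 1)) x x) := by
  have h := (contMDiffAt_iff.1 (hf.contMDiffAt (x := x))).2
  rw [ModelWithCorners.range_eq_univ, contDiffWithinAt_univ] at h
  exact h

theorem coordMap_self (ι : S → M) (p : S) :
    coordMap ι p (extChartAt (𝓡 n) p p) = extChartAt (𝓡 (n + 1)) (ι p) (ι p) := by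
  simp [coordMap, writtenInExtChartAt]

theorem contDiffAt_coordMap (hι : ContMDiff (𝓡 n) (𝓡 (n + 1)) ∞ ι) (p : S) :
    ContDiffAt ℝ ∞ (coordMap ι p) (extChartAt (𝓡 n) p p) := by
  have h := (contMDiffAt_iff.1 (hι.contMDiffAt (x := p))).2
  rw [ModelWithCorners.range_eq_univ, contDiffWithinAt_univ] at h
  exact h

theorem mfderiv_eq_fderiv_coordMap (hι : ContMDiff (𝓡 n) (𝓡 (n + 1)) ∞ ι) (p : S) :
    mfderiv (𝓡 n) (𝓡 (n + 1)) ι p = fderiv ℝ (coordMap ι p) (extChartAt (𝓡 n) p p) := by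
  have h := (hι.mdifferentiable (by simp) p).mfderiv
  rw [ModelWithCorners.range_eq_univ, fderivWithin_univ] at h
  exact h

theorem isLocalMax_coordFun_comp_coordMap {f : M → ℝ} (hι : Continuous ι) {p : S}
    (hp : ∀ q, f (ι q) ≤ f (ι p)) :
    IsLocalMax (coordFun f (ι p) ∘ coordMap ι p) (extChartAt (𝓡 n) p p) := by
  have h1 : Filter.Tendsto (ι ∘ (extChartAt (𝓡 n) p).symm) (nhds (extChartAt (𝓡 n) p p))
      (nhds (ι p)) := by
    have := hι.continuousAt.comp (continuousAt_extChartAt_symm (I := 𝓡 n) p)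
    simpa [ContinuousAt] using this
  filter_upwards [h1.eventually (extChartAt_source_mem_nhds (I := 𝓡 (n + 1)) (ι p))] with z hz
  simp only [Function.comp_apply, coordMap_self, coordFun, extChartAt_to_inv]
  simp only [coordMap, writtenInExtChartAt, Function.comp_apply]
  rw [PartialEquiv.left_inv _ hz]
  exact hp _

end

/-! ### Christoffel symbols and the Hessian as bilinear maps -/

section

variable {n : ℕ} {M : Type*} [TopologicalSpace M] [ChartedSpace (Model (n + 1)) M]
  [IsManifold (𝓡 (n + 1)) ∞ M]

/-- The part `Γ^c_{ab} v^a w^b ∂_c` of a covariant derivative. -/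
noncomputable def LorentzianMetric.christoffelForm (g : LorentzianMetric n M) (x : M) :
    Model (n + 1) →ₗ[ℝ] Model (n + 1) →ₗ[ℝ] Model (n + 1) :=
  LinearMap.mk₂ ℝ (fun v w => ∑ c, (∑ a, ∑ b, g.christoffel x c a b * v a * w b) • e c)
    (fun v v' w => by simp [mul_add, add_mul, Finset.sum_add_distrib, add_smul])
    (fun r v w => by
      simp only [Finset.smul_sum, smul_smul, Finset.mul_sum, PiLp.smul_apply, smul_eq_mul,
        mul_left_comm, mul_assoc])
    (fun v w w' => by simp [mul_add, Finset.sum_add_distrib, add_smul])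
    (fun r v w => by
      simp only [Finset.smul_sum, smul_smul, Finset.mul_sum, PiLp.smul_apply, smul_eq_mul,
        mul_left_comm, mul_assoc])

theorem sum_smul_e {m : ℕ} (v : Model m) : ∑ i, v i • e i = v := by
  simpa [e] using (EuclideanSpace.basisFun (Fin m) ℝ).sum_repr v

theorem bilin_eq_sum {m : ℕ} {E : Type*} [AddCommGroup E] [Module ℝ E]
    (B : Model m →ₗ[ℝ] Model m →ₗ[ℝ] E) (v w : Model m) :
    B v w = ∑ i, ∑ j, (v i * w j) • B (e i) (e j) := by
  conv_lhs => rw [← sum_smul_e v, ← sum_smul_e w]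
  simp only [map_sum, map_smul, LinearMap.sum_apply, LinearMap.smul_apply, Finset.smul_sum,
    smul_smul]
  rw [Finset.sum_comm]
  exact Finset.sum_congr rfl fun i _ => Finset.sum_congr rfl fun j _ => by rw [mul_comm]

theorem continuousBilin_eq_sum {m : ℕ} {E : Type*} [NormedAddCommGroup E] [NormedSpace ℝ E]
    (B : Model m →L[ℝ] Model m →L[ℝ] E) (v w : Model m) :
    B v w = ∑ i, ∑ j, (v i * w j) • B (e i) (e j) :=
  bilin_eq_sum B.toLinearMap₁₂ v w

theorem LorentzianMetric.christoffelForm_basis (g : LorentzianMetric n M) (x : M)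
    (a b : Fin (n + 1)) :
    g.christoffelForm x (e a) (e b) = ∑ c, g.christoffel x c a b • e c := by
  simp [christoffelForm, e]

theorem LorentzianMetric.hessian_apply (g : LorentzianMetric n M) (f : M → ℝ) (x : M)
    (v w : Model (n + 1)) :
    g.hessian f x v w =
      fderiv ℝ (fderiv ℝ (coordFun f x)) (extChartAt (𝓡 (n + 1)) x x) v w -
        fderiv ℝ (coordFun f x) (extChartAt (𝓡 (n + 1)) x x) (g.christoffelForm x v w) := by
  rw [continuousBilin_eq_sum (fderiv ℝ (fderiv ℝ (coordFun f x)) _),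
    bilin_eq_sum (g.christoffelForm x), hessian, Matrix.toBilin_apply]
  simp only [hessianCoord, Matrix.of_apply, OrthonormalBasis.coe_toBasis_repr_apply,
    EuclideanSpace.basisFun_repr, christoffelForm_basis, map_sum, map_smul, smul_eq_mul,
    ← Finset.sum_sub_distrib]
  exact Finset.sum_congr rfl fun i _ => Finset.sum_congr rfl fun j _ => by ring

end

/-! ### Derivatives of `f` along the hypersurface at a maximum -/

section

variable {n : ℕ} {M : Type*} [TopologicalSpace M] [ChartedSpace (Model (n + 1)) M]
  [IsManifold (𝓡 (n + 1)) ∞ M] {S : Type*} [TopologicalSpace S] [ChartedSpace (Model n) S]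
  {g : LorentzianMetric n M} {ι : S → M}

/-- The covariant derivative `∇_i ∂_j ι`, as a vector of the model space. -/
noncomputable def covDerivVector (g : LorentzianMetric n M) (ι : S → M) (p : S) (i j : Fin n) :
    Model (n + 1) :=
  covDeriv g ι p i j

theorem sum_mul_covDeriv (g : LorentzianMetric n M) (ι : S → M) (p : S) (v : Model n) :
    ∑ i, ∑ j, (v i * v j) • covDerivVector g ι p i j =
      fderiv ℝ (fderiv ℝ (coordMap ι p)) (extChartAt (𝓡 n) p p) v v +
        g.christoffelForm (ι p) (fderiv ℝ (coordMap ι p) (extChartAt (𝓡 n) p p) v)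
          (fderiv ℝ (coordMap ι p) (extChartAt (𝓡 n) p p) v) := by
  have h2 := bilin_eq_sum ((g.christoffelForm (ι p)).compl₁₂
    (fderiv ℝ (coordMap ι p) (extChartAt (𝓡 n) p p)).toLinearMap
    (fderiv ℝ (coordMap ι p) (extChartAt (𝓡 n) p p)).toLinearMap) v v
  simp only [LinearMap.compl₁₂_apply, ContinuousLinearMap.coe_coe] at h2
  rw [continuousBilin_eq_sum (fderiv ℝ (fderiv ℝ (coordMap ι p)) _), h2]
  simp only [← Finset.sum_add_distrib, ← smul_add]
  rfl

/-- At a maximum point on the hypersurface, the tangential derivatives of `f` vanish and the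
Hessian of `f ∘ ι` along the hypersurface is nonpositive. -/
theorem maximum_point_conditions (hι : ContMDiff (𝓡 n) (𝓡 (n + 1)) ∞ ι) {f : M → ℝ}
    (hf : ContMDiff (𝓡 (n + 1)) 𝓘(ℝ, ℝ) ∞ f) {p : S} (hp : ∀ q, f (ι q) ≤ f (ι p))
    (v : Model n) :
    fderiv ℝ (coordFun f (ι p)) (extChartAt (𝓡 (n + 1)) (ι p) (ι p))
      (fderiv ℝ (coordMap ι p) (extChartAt (𝓡 n) p p) v) = 0 ∧
    g.hessian f (ι p) (fderiv ℝ (coordMap ι p) (extChartAt (𝓡 n) p p) v)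
        (fderiv ℝ (coordMap ι p) (extChartAt (𝓡 n) p p) v) +
      fderiv ℝ (coordFun f (ι p)) (extChartAt (𝓡 (n + 1)) (ι p) (ι p))
        (∑ i, ∑ j, (v i * v j) • covDerivVector g ι p i j) ≤ 0 := by
  have hmax := isLocalMax_coordFun_comp_coordMap (n := n) hι.continuous hp
  have hφ := contDiffAt_coordMap hι p
  have hF := contDiffAt_coordFun hf (ι p)
  rw [← coordMap_self] at hF
  have h2 : (2 : ℕ∞ω) ≤ ∞ := WithTop.coe_le_coe.2 (le_top : (2 : ℕ∞) ≤ ⊤)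
  have hu := ContDiffAt.comp _ hF hφ
  constructor
  · have h := hmax.fderiv_eq_zero
    rw [fderiv_comp _ (hF.differentiableAt (by simp)) (hφ.differentiableAt (by simp)),
      coordMap_self] at h
    exact DFunLike.congr_fun h v
  · have h := hmax.fderiv_fderiv_nonpos (hu.of_le h2) v
    rw [fderiv_fderiv_comp_apply (hF.of_le h2) (hφ.of_le h2), coordMap_self] at h
    -- The Christoffel term subtracted in the Hessian of `f` cancels the one added in the covariant
    -- derivative, leaving the plain second derivative of the composition.
    rw [g.hessian_apply, sum_mul_covDeriv, map_add]
    linarith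

end

/-! ### The contradiction at a maximum point -/

theorem not_compactSpace_of_isMaximal {n : ℕ} (hn : 1 ≤ n)
    {M : Type*} [TopologicalSpace M] [ChartedSpace (Model (n + 1)) M]
    [IsManifold (𝓡 (n + 1)) ∞ M] (g : LorentzianMetric n M)
    (f : M → ℝ) (hf : IsSpacetimeConvex g f)
    {S : Type*} [TopologicalSpace S] [ChartedSpace (Model n) S] [Nonempty S]
    (ι : S → M) (hι : IsSpacelikeHypersurface g ι) (hmax : IsMaximal g ι) :
    ¬ CompactSpace S := by
  intro _
  obtain ⟨p, -, hp'⟩ := isCompact_univ.exists_isMaxOn Set.univ_nonempty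
    (hf.smooth.continuous.comp hι.smooth.continuous).continuousOn
  have hp : ∀ q, f (ι q) ≤ f (ι p) := fun q => hp' (Set.mem_univ q)
  obtain ⟨c, hc, hconv⟩ := hf.convex
  have hcond := maximum_point_conditions (g := g) hι.smooth hf.smooth hp
  have hD := mfderiv_eq_fderiv_coordMap hι.smooth p
  set D : Model n →L[ℝ] Model (n + 1) := fderiv ℝ (coordMap ι p) (extChartAt (𝓡 n) p p)
  set dF : Model (n + 1) →L[ℝ] ℝ :=
    fderiv ℝ (coordFun f (ι p)) (extChartAt (𝓡 (n + 1)) (ι p) (ι p))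
  let G : Model (n + 1) →L[ℝ] Model (n + 1) →L[ℝ] ℝ := g.inner (ι p)
  have hGsymm : ∀ v w, G v w = G w v := g.symm (ι p)
  have hpos : ∀ v : Model n, v ≠ 0 → 0 < G (D v) (D v) := fun v hv => by
    have := hι.spacelike p v hv
    rwa [hD] at this
  have hh : ∀ i j, inducedMetric g ι p i j = G (D (e i)) (D (e j)) := fun i j => by
    rw [inducedMetric, hD]; rfl
  obtain ⟨t, ht⟩ := (g.lorentzian (ι p)).exists_neg
  obtain ⟨ν, hν, hνD, hdec⟩ := exists_timelike_unit_normal (asBilin G) hGsymm D.toLinearMap hpos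
    (by simp) ht
  have hHv : ∀ v : Model n, G (D v) (D v) = ∑ i, ∑ j, v i * v j * inducedMetric g ι p i j :=
    fun v => by
      simp only [hh]
      exact bilin_eq_sum (LinearMap.compl₁₂ (asBilin G) D.toLinearMap D.toLinearMap) v v
  have hPD : (inducedMetric g ι p).PosDef := by
    refine Matrix.PosDef.of_dotProduct_mulVec_pos ?_ fun v hv => ?_
    · ext i j
      simp [hh, hGsymm (D (e i))]
    · have h := hpos (WithLp.toLp 2 v) (by simpa using hv)
      rw [hHv] at h
      simpa [dotProduct, Matrix.mulVec, Finset.mul_sum, mul_assoc, mul_comm] using h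
  have hunit : IsUnitNormal g ι p ν := ⟨hν, fun v => by rw [hD]; exact hνD v⟩
  -- Since `dF` vanishes on tangent vectors, only the normal component of `x` contributes.
  have hcov : ∀ x, dF x = -(G ν x) * dF ν := fun x => by
    obtain ⟨v, hv⟩ := hdec x
    have h0 : dF (D v) = 0 := (hcond v).1
    conv_lhs => rw [hv]
    rw [map_sub, map_smul, smul_eq_mul]
    change dF (D v) - G ν x * dF ν = _
    rw [h0]; ring
  -- This combines `c h ≤ ∇∇f` on tangent vectors with the second order condition, where `K = -g(ν,
  -- ∇∂ι)` turns `dF` of the covariant derivative into `dF ν * K`.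
  have hA : ∀ v : Fin n → ℝ, 0 ≤ ∑ i, ∑ j, v i * v j *
      (-(dF ν) * secondFundamentalForm g ι p ν i j - c * inducedMetric g ι p i j) := fun v => by
    have h1 := (hcond (WithLp.toLp 2 v)).2
    have h2 : c * G (D (WithLp.toLp 2 v)) (D (WithLp.toLp 2 v)) ≤ _ :=
      hconv (ι p) (D (WithLp.toLp 2 v))
    have h3 : dF (∑ i, ∑ j, (v i * v j) • covDerivVector g ι p i j) =
        ∑ i, ∑ j, v i * v j * (dF ν * secondFundamentalForm g ι p ν i j) := by
      simp only [map_sum, map_smul, smul_eq_mul]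
      refine Finset.sum_congr rfl fun i _ => Finset.sum_congr rfl fun j _ => ?_
      rw [hcov]
      change v i * v j * (_ * _) = v i * v j * (dF ν * -(G ν (covDerivVector g ι p i j)))
      ring
    rw [hHv] at h2
    simp only [h3] at h1
    have h4 : ∑ i, ∑ j, v i * v j *
        (-(dF ν) * secondFundamentalForm g ι p ν i j - c * inducedMetric g ι p i j) =
        -(∑ i, ∑ j, v i * v j * (dF ν * secondFundamentalForm g ι p ν i j)) -
          c * ∑ i, ∑ j, v i * v j * inducedMetric g ι p i j := by
      simp only [Finset.mul_sum, ← Finset.sum_neg_distrib, ← Finset.sum_sub_distrib]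
      exact Finset.sum_congr rfl fun i _ => Finset.sum_congr rfl fun j _ => by ring
    rw [h4]
    linarith
  have hfinal := sum_inv_mul_nonneg (A := Matrix.of fun i j =>
    -(dF ν) * secondFundamentalForm g ι p ν i j - c * inducedMetric g ι p i j) hPD hA
  have htr : ∑ i, ∑ j, (inducedMetric g ι p)⁻¹ i j * inducedMetric g ι p i j = n := by
    have h1 : (inducedMetric g ι p)⁻¹ * inducedMetric g ι p = 1 :=
      Matrix.nonsing_inv_mul _ ((Matrix.isUnit_iff_isUnit_det _).1 hPD.isUnit)
    have h2 := congrArg Matrix.trace h1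
    rw [Matrix.trace_one, Fintype.card_fin] at h2
    rw [← h2, Matrix.trace]
    refine Finset.sum_congr rfl fun i _ => ?_
    rw [Matrix.diag_apply, Matrix.mul_apply]
    refine Finset.sum_congr rfl fun j _ => ?_
    rw [hh, hGsymm, ← hh]
  have hmean := hmax p ν hunit
  have hsum : ∑ i, ∑ j, (inducedMetric g ι p)⁻¹ i j *
      (-(dF ν) * secondFundamentalForm g ι p ν i j - c * inducedMetric g ι p i j) =
      -(dF ν) * meanCurvature g ι p ν - c * n := by
    rw [← htr]
    simp only [meanCurvature, Finset.mul_sum, ← Finset.sum_sub_distrib]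
    exact Finset.sum_congr rfl fun i _ => Finset.sum_congr rfl fun j _ => by ring
  simp only [Matrix.of_apply] at hfinal
  rw [hsum, hmean] at hfinal
  have : (1 : ℝ) ≤ n := by exact_mod_cast hn
  -- What remains is `0 ≤ -c n`, impossible for `c > 0` and `n ≥ 1`.
  nlinarith

end SpacetimeConvex

theorem mainTheorem5 (n : ℕ) (hn : 1 ≤ n)
    {M : Type*} [TopologicalSpace M] [ChartedSpace (SpacetimeConvex.Model (n + 1)) M]
    [IsManifold (𝓡 (n + 1)) ∞ M]
    (g : SpacetimeConvex.LorentzianMetric n M)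
    (f : M → ℝ) (hf : SpacetimeConvex.IsSpacetimeConvex g f)
    {S : Type*} [TopologicalSpace S] [ChartedSpace (SpacetimeConvex.Model n) S]
    [IsManifold (𝓡 n) ∞ S] [Nonempty S]
    (ι : S → M) (hι : SpacetimeConvex.IsSpacelikeHypersurface g ι)
    (hmax : SpacetimeConvex.IsMaximal g ι) :
    ¬ CompactSpace S := by
  exact SpacetimeConvex.not_compactSpace_of_isMaximal hn g f hf ι hι hmax
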